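/- Let $B$ be a stationary Bratteli diagram: the levels are $V_0=\{v_0\}$ and $V_n$ ($n\ge 1$), each $V_n$ with $n\ge1$ being a copy of one finite set $V$; each edge set $E_n$ ($n\ge 2$) between $V_{n-1}$ and $V_n$ is a copy of one finite set $E$ with the same source and range maps $s,r\colon E\to V$, both onto; and $v_0$ is joined by exactly one edge to each vertex of $V_1$. Let $F=(f_{vw})_{v,w\in V}$, $f_{vw}=|\{e\in E: r(e)=v,\ s(e)=w\}|$, be its incidence matrix and $A=F^T$. Let $X_B$ be the space of infinite paths starting at $v_0$, with the topology generated by the cylinder sets, and let $\mathcal R$ be the tail equivalence relation on $X_B$ (two paths are equivalent if they coincide from some level on). Let $\mu$ be a Borel probability measure on $X_B$ that is $\mathcal R$-invariant (cylinder sets of any two finite paths from $v_0$ to the same vertex have equal measure) and ergodic (every $\mathcal R$-saturated Borel set has measure $0$ or $1$). Suppose that $\mu$ is defined by a distinguished eigenvalue $\lambda$ of $A$: there is a vector $y=(y_v)_{v\in V}$ with $y_v\ge 0$, $\sum_v y_v=1$ and $Ay=\lambda y$ such that $\mu(X^{(n)}_v(\overline e))=y_v/\lambda^{n-1}$ for every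 $n\ge 1$, every vertex $v\in V_n$ and every finite path $\overline e$ from $v_0$ to $v$, where $X^{(n)}_v(\overline e)$ is the cylinder set of all infinite paths that begin with $\overline e$. Suppose also that $\mathcal R$ is aperiodic on the support of $\mu$, i.e. the $\mathcal R$-class of every path in the support of $\mu$ is infinite. Let $(x_1,\dots,x_n)$ be the reduced vector, obtained from $y$ by crossing out the zero entries, let $H$ be the additive subgroup of $\mathbb R$ generated by $x_1,\dots,x_n$, and let $S(\mu)=\{\mu(U): U\subset X_B \text{ clopen}\}$ be the clopen values set. Then $S(\mu)$ is group-like, i.e. $S(\mu)=G\cap[0,1]$ for some additive subgroup $G$ of $\mathbb R$, and $$S(\mu)=\Bigl(\bigcup_{N=0}^{\infty}\frac{1}{\lambda^{N}}H\Bigr)\cap[0,1].$$ -/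

import Mathlib

open MeasureTheory Set

/-- A stationary Bratteli diagram. Every level `V_n`, `n ≥ 1`, is a copy of the finite set `V`, and
every edge set `E_n`, `n ≥ 2`, between the levels `n - 1` and `n` is a copy of the finite set `E`,
with source map `s : E → V` and range map `r : E → V` (both onto: every vertex emits an edge and
every vertex below the first level receives one). The top level is a single vertex `v₀`, joined
by exactly one edge to each vertex of `V_1`, so that `E_1` is a copy of `V`. -/
structure StationaryBratteliDiagram (V E : Type*) where
  /-- source of an edge (in the upper level) -/
  s : E → V
  /-- range of an edge (in the next level) -/
  r : E → V
  s_surjective : Function.Surjective s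
  r_surjective : Function.Surjective r

namespace StationaryBratteliDiagram

variable {V E : Type*}

/-- The incidence matrix `F`: `F v w` is the number of edges with range `v` and source `w`. -/
noncomputable def incidence (B : StationaryBratteliDiagram V E) : Matrix V V ℕ :=
  fun v w => Nat.card {e : E // B.r e = v ∧ B.s e = w}

/-- The matrix `A = Fᵀ`, with real entries. -/
noncomputable def A (B : StationaryBratteliDiagram V E) : Matrix V V ℝ :=
  (B.incidence.transpose).map (fun k : ℕ => (k : ℝ))

/-- The space `X_B` of infinite paths that start at `v₀`. The first edge of a path, from `v₀` to
the source of its second edge, is determined by the second edge and is not recorded: `x.1 k` is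
the edge of `x` from level `k + 1` to level `k + 2`. -/
def PathSpace (B : StationaryBratteliDiagram V E) : Type _ :=
  {x : ℕ → E // ∀ k, B.r (x k) = B.s (x (k + 1))}

variable {B : StationaryBratteliDiagram V E}

/-- The vertex of the level `n + 1` through which the path passes. -/
def PathSpace.vertex (x : B.PathSpace) (n : ℕ) : V := B.s (x.1 n)

/-- The cylinder set of all paths that have the same initial segment as `z` from `v₀` down to the
level `n + 1`, i.e. the same `n + 1` first edges (the condition on the vertex says for `n = 0` that
the unrecorded first edges agree; for `n ≥ 1` it follows from the other one).
Every finite path from `v₀` is such an initial segment, as every vertex emits an edge. -/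
def PathSpace.cylinder (z : B.PathSpace) (n : ℕ) : Set B.PathSpace :=
  {x | x.vertex n = z.vertex n ∧ ∀ k < n, x.1 k = z.1 k}

/-- The topology generated by the cylinder sets, as the one induced by the product topology on
`ℕ → E`, with `E` discrete. -/
instance : TopologicalSpace B.PathSpace :=
  TopologicalSpace.induced (fun x : B.PathSpace => x.1)
    (@Pi.topologicalSpace ℕ (fun _ => E) (fun _ => ⊥))

/-- The Borel σ-algebra of the path space. -/
instance : MeasurableSpace B.PathSpace := borel _

instance : BorelSpace B.PathSpace := ⟨rfl⟩

/-- The tail equivalence relation `R`. -/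
def TailEquiv (x y : B.PathSpace) : Prop := ∃ k₀, ∀ k ≥ k₀, x.1 k = y.1 k

/-- `μ` is `R`-invariant: the cylinder sets of any two finite paths from `v₀` to the same vertex of
the same level have equal measure. -/
def IsTailInvariant (μ : Measure B.PathSpace) : Prop :=
  ∀ (n : ℕ) (z w : B.PathSpace), z.vertex n = w.vertex n → μ (z.cylinder n) = μ (w.cylinder n)

/-- `μ` is ergodic for `R`: every Borel set that is a union of `R`-classes is null or conull. -/
def IsTailErgodic (μ : Measure B.PathSpace) : Prop :=
  ∀ S : Set B.PathSpace, MeasurableSet S → (∀ x y, TailEquiv x y → (x ∈ S ↔ y ∈ S)) →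
    μ S = 0 ∨ μ Sᶜ = 0

/-- `lam` is a distinguished eigenvalue of `A = Fᵀ`, and `y` is a non-negative probability
eigenvector of `A` corresponding to `lam`. -/
structure IsDistinguishedEigenpair [Fintype V] (B : StationaryBratteliDiagram V E)
    (lam : ℝ) (y : V → ℝ) : Prop where
  nonneg : ∀ v, 0 ≤ y v
  sum_eq_one : ∑ v, y v = 1
  eigen : B.A.mulVec y = lam • y

/-- `μ` is the measure on `X_B` defined by `lam` and `y`: the cylinder set of a finite path from
`v₀` to the vertex `i` of the level `m = n + 1` has measure `y i / lam ^ (m - 1)`. (These values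
determine a Borel measure on `X_B`.) -/
def IsDefinedBy (μ : Measure B.PathSpace) (lam : ℝ) (y : V → ℝ) : Prop :=
  ∀ (n : ℕ) (z : B.PathSpace), μ.real (z.cylinder n) = y (z.vertex n) / lam ^ n

end StationaryBratteliDiagram

/-- The reduced vector of `y`: cross out the zero entries. -/
def reducedVector {V : Type*} (y : V → ℝ) : {v : V // y v ≠ 0} → ℝ := fun v => y v

/-- The clopen values set `S(μ)`. -/
def clopenValues {X : Type*} [TopologicalSpace X] [MeasurableSpace X] (μ : Measure X) : Set ℝ :=
  {t | ∃ U : Set X, IsClopen U ∧ μ.real U = t}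

/-- A set of reals is group-like if it is `G ∩ [0, 1]` for an additive subgroup `G` of `ℝ`. -/
def IsGroupLike (S : Set ℝ) : Prop := ∃ G : AddSubgroup ℝ, S = (G : Set ℝ) ∩ Icc 0 1

/-! ### Column stochastic matrices: contraction, recurrence and limits. -/

section Stochastic

open Filter Topology Matrix

/-! A clopen set is a finite union of cylinders of one level, so its measure is `(∑ v, y v * k v) /
lam ^ n` with integers `0 ≤ k v ≤ height n v`, and every such number occurs. The difficulty is to
bring an arbitrary integer representation of `t ∈ (0, 1)` into these bounds. Iterating `F` on the
coefficients passes to deeper levels without changing the number represented, and the heights evolve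
by the same recursion.

On the support of `y` the conjugate `P = D_y F D_y⁻¹ / lam` is column stochastic. If some `P ^ n *ᵥ
u` with `∑ u = 0` did not tend to zero, the signs of a limit point would give two disjoint closed
families of vertices (`exists_disjoint_closed_of_not_tendsto`), hence two disjoint invariant sets of
positive measure, against ergodicity. So the powers of `P` converge to the projection on a
stationary vector `p`. Where `p v > 0`, the coefficient and the height are asymptotically in the
ratio `t`, which lies strictly between `0` and `1`.

Where `p v = 0` the limit says nothing, and arithmetic takes over. By `mem_span_of_tendsto` and the
algebraicity of `lam`, some positive multiple `M v * y v` lies in the group generated by the `y w`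
with `p w ≠ 0`. The coefficient at `v` can thus be reduced modulo `M v`. Aperiodicity makes the
heights unbounded, hence larger than `M v`, and the bounds then persist because these vertices
receive edges only from vertices of the same kind. `exists_le_height_sum_eq` joins the two halves.
-/

/-- Column sums `1` make `mulVec` preserve the sum of the coordinates. -/
theorem sum_mulVec_of_colSum {I : Type*} [Fintype I] {P : Matrix I I ℝ}
    (h1 : ∀ w, ∑ v, P v w = 1) (u : I → ℝ) : ∑ v, (P *ᵥ u) v = ∑ w, u w := by
  simp only [Matrix.mulVec, dotProduct]
  rw [Finset.sum_comm]
  simp [← Finset.sum_mul, h1]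

theorem sum_abs_mulVec_le {I : Type*} [Fintype I] {P : Matrix I I ℝ} (h0 : ∀ v w, 0 ≤ P v w)
    (h1 : ∀ w, ∑ v, P v w = 1) (u : I → ℝ) : ∑ v, |(P *ᵥ u) v| ≤ ∑ w, |u w| := by
  rw [← sum_mulVec_of_colSum h1 (fun w => |u w|)]
  refine Finset.sum_le_sum fun v _ => ?_
  simp only [Matrix.mulVec, dotProduct]
  refine (Finset.abs_sum_le_sum_abs _ _).trans (Finset.sum_le_sum fun w _ => ?_)
  rw [abs_mul, abs_of_nonneg (h0 v w)]

theorem sum_pow_mulVec_of_colSum {I : Type*} [Fintype I] [DecidableEq I] {P : Matrix I I ℝ}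
    (h1 : ∀ w, ∑ v, P v w = 1) (u : I → ℝ) (n : ℕ) : ∑ v, ((P ^ n) *ᵥ u) v = ∑ w, u w := by
  induction n with
  | zero => simp
  | succ n ih => rw [pow_succ', ← Matrix.mulVec_mulVec, sum_mulVec_of_colSum h1, ih]

/-- If a column stochastic matrix does not decrease the `ℓ¹` norm of `c`, then positive
coordinates are sent to positive coordinates only. -/
theorem mulVec_pos_of_sum_abs_eq {I : Type*} [Fintype I] {P : Matrix I I ℝ}
    (h0 : ∀ v w, 0 ≤ P v w) (h1 : ∀ w, ∑ v, P v w = 1) {c : I → ℝ}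
    (hc : ∑ v, |(P *ᵥ c) v| = ∑ w, |c w|) {v w : I} (hw : 0 < c w) (hvw : 0 < P v w) :
    0 < (P *ᵥ c) v := by
  rw [← sum_mulVec_of_colSum h1 (fun w => |c w|)] at hc
  have hle : ∀ v ∈ Finset.univ, |(P *ᵥ c) v| ≤ (P *ᵥ (fun w => |c w|)) v := by
    intro v _
    simp only [Matrix.mulVec, dotProduct]
    refine (Finset.abs_sum_le_sum_abs _ _).trans (Finset.sum_le_sum fun w _ => ?_)
    rw [abs_mul, abs_of_nonneg (h0 v w)]
  have heq := (Finset.sum_eq_sum_iff_of_le hle).1 hc v (Finset.mem_univ v)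
  by_contra! hneg
  rw [abs_of_nonpos hneg] at heq
  -- Equality in the triangle inequality with a nonpositive value forces every term to be
  -- nonpositive.
  have hz : ∑ w, P v w * (|c w| + c w) = 0 := by
    simp only [mul_add, Finset.sum_add_distrib]
    simp only [Matrix.mulVec, dotProduct] at heq
    linarith
  have := (Finset.sum_eq_zero_iff_of_nonneg (fun w _ =>
    mul_nonneg (h0 v w) (by linarith [neg_abs_le (c w)]))).1 hz w (Finset.mem_univ w)
  rw [abs_of_pos hw] at this
  nlinarith [mul_pos hvw hw]

/-- If the powers of a column stochastic matrix do not kill a vector with sum zero, then there are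
two disjoint sequences of nonempty sets of states that are closed under the transitions. -/
theorem exists_disjoint_closed_of_not_tendsto {I : Type*} [Fintype I] [DecidableEq I]
    {P : Matrix I I ℝ} (h0 : ∀ v w, 0 ≤ P v w) (h1 : ∀ w, ∑ v, P v w = 1) {u : I → ℝ}
    (hu : ∑ v, u v = 0) (hlim : ¬ Tendsto (fun n => (P ^ n) *ᵥ u) atTop (𝓝 0)) :
    ∃ A B : ℕ → Set I, (A 0).Nonempty ∧ (B 0).Nonempty ∧ (∀ k, Disjoint (A k) (B k)) ∧
      (∀ k v w, w ∈ A k → 0 < P v w → v ∈ A (k + 1)) ∧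
      (∀ k v w, w ∈ B k → 0 < P v w → v ∈ B (k + 1)) := by
  set N : (I → ℝ) → ℝ := fun x => ∑ v, |x v| with hN
  have hNc : Continuous N := by fun_prop
  have hN0 : ∀ x, 0 ≤ N x := fun x => Finset.sum_nonneg fun v _ => abs_nonneg _
  have hle : ∀ (x : I → ℝ) v, |x v| ≤ N x := fun x v =>
    Finset.single_le_sum (f := fun v => |x v|) (fun v _ => abs_nonneg _) (Finset.mem_univ v)
  have hstep : ∀ n x, (P ^ (n + 1)) *ᵥ x = P *ᵥ ((P ^ n) *ᵥ x) := fun n x => by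
    rw [pow_succ', Matrix.mulVec_mulVec]
  have hanti : Antitone fun n => N ((P ^ n) *ᵥ u) := by
    refine antitone_nat_of_succ_le fun n => ?_
    rw [hstep]
    exact sum_abs_mulVec_le h0 h1 _
  obtain ⟨d, hd⟩ : ∃ d, Tendsto (fun n => N ((P ^ n) *ᵥ u)) atTop (𝓝 d) :=
    ⟨_, tendsto_atTop_ciInf hanti ⟨0, by rintro _ ⟨n, rfl⟩; exact hN0 _⟩⟩
  have hd0 : d ≠ 0 := by
    rintro rfl
    refine hlim (tendsto_pi_nhds.2 fun v => ?_)
    exact squeeze_zero_norm (fun n => hle _ v) hd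
  obtain ⟨c, -, φ, hφ, hc⟩ := (isCompact_closedBall (0 : I → ℝ) (N u)).tendsto_subseq
    (x := fun n => (P ^ n) *ᵥ u) (fun n => by
      rw [mem_closedBall_zero_iff, pi_norm_le_iff_of_nonneg (hN0 u)]
      intro v
      refine (hle _ v).trans ?_
      simpa using hanti (Nat.zero_le n))
  have hcont : ∀ k, Continuous fun x : I → ℝ => (P ^ k) *ᵥ x := fun k => by fun_prop
  -- The shifted orbits have the same limiting norm, so the norm is constant along the orbit of the
  -- limit point.
  have hck : ∀ k, N ((P ^ k) *ᵥ c) = d := by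
    intro k
    have e1 := ((hNc.comp (hcont k)).tendsto c).comp hc
    have e2 : Tendsto (fun n => N ((P ^ (k + φ n)) *ᵥ u)) atTop (𝓝 d) :=
      hd.comp (tendsto_atTop_mono (fun n => Nat.le_add_left _ _) hφ.tendsto_atTop)
    refine tendsto_nhds_unique e1 (e2.congr fun n => ?_)
    simp [pow_add, Matrix.mulVec_mulVec]
  have hcs : ∑ v, c v = 0 := by
    have e1 := ((show Continuous fun x : I → ℝ => ∑ v, x v by fun_prop).tendsto c).comp hc
    refine tendsto_nhds_unique e1 (tendsto_const_nhds.congr fun n => ?_)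
    simp [sum_pow_mulVec_of_colSum h1, hu]
  have hiso : ∀ k, ∑ v, |(P *ᵥ ((P ^ k) *ᵥ c)) v| = ∑ v, |((P ^ k) *ᵥ c) v| := by
    intro k
    rw [← hstep]
    exact (hck (k + 1)).trans (hck k).symm
  have hc0 : c ≠ 0 := by
    rintro rfl
    have := hck 0
    simp [hN] at this
    exact hd0 this.symm
  have key : ∃ v, c v ≠ 0 := Function.ne_iff.1 hc0
  refine ⟨fun k => {v | 0 < ((P ^ k) *ᵥ c) v}, fun k => {v | ((P ^ k) *ᵥ c) v < 0},
    ?_, ?_, ?_, ?_, ?_⟩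
  · obtain ⟨v, hv⟩ := key
    obtain ⟨w, -, hw⟩ := Finset.exists_pos_of_sum_zero_of_exists_nonzero c hcs ⟨v, by simp, hv⟩
    exact ⟨w, by simpa using hw⟩
  · obtain ⟨v, hv⟩ := key
    obtain ⟨w, -, hw⟩ := Finset.exists_pos_of_sum_zero_of_exists_nonzero (s := Finset.univ) (-c)
      (by simp [hcs]) ⟨v, by simp, by simpa using hv⟩
    exact ⟨w, by simpa using hw⟩
  · intro k
    rw [Set.disjoint_left]
    intro v hv hv'
    simp only [mem_ofPred_eq] at hv hv'
    exact lt_asymm hv hv'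
  · intro k v w hw hvw
    simp only [mem_ofPred_eq, hstep]
    exact mulVec_pos_of_sum_abs_eq h0 h1 (hiso k) hw hvw
  · intro k v w hw hvw
    simp only [mem_ofPred_eq, hstep] at hw ⊢
    have := mulVec_pos_of_sum_abs_eq (c := -((P ^ k) *ᵥ c)) h0 h1
      (by simpa [Matrix.mulVec_neg] using hiso k) (w := w) (by simpa using hw) hvw
    simpa [Matrix.mulVec_neg] using this

/-- If the powers of a column stochastic matrix kill all vectors with sum zero, then they converge
to the projection on a stationary probability vector. -/
theorem exists_stationary_of_tendsto {I : Type*} [Fintype I] [DecidableEq I] [Nonempty I]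
    {P : Matrix I I ℝ} (h0 : ∀ v w, 0 ≤ P v w) (h1 : ∀ w, ∑ v, P v w = 1)
    (h : ∀ u : I → ℝ, ∑ v, u v = 0 → Tendsto (fun n => (P ^ n) *ᵥ u) atTop (𝓝 0)) :
    ∃ p : I → ℝ, (∀ v, 0 ≤ p v) ∧ P *ᵥ p = p ∧
      ∀ u : I → ℝ, Tendsto (fun n => (P ^ n) *ᵥ u) atTop (𝓝 ((∑ v, u v) • p)) := by
  obtain ⟨i⟩ := ‹Nonempty I›
  set e : I → ℝ := Pi.single i 1 with he
  have hes : ∑ v, e v = 1 := by simp [he]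
  have hPn : ∀ n v w, 0 ≤ (P ^ n) v w := by
    intro n
    induction n with
    | zero => intro v w; by_cases hvw : v = w <;> simp [hvw]
    | succ n ih =>
      intro v w
      rw [pow_succ, Matrix.mul_apply]
      exact Finset.sum_nonneg fun x _ => mul_nonneg (ih v x) (h0 x w)
  have hpos : ∀ n v, 0 ≤ ((P ^ n) *ᵥ e) v := by
    intro n v
    simpa [he] using hPn n v i
  obtain ⟨p, -, φ, hφ, hp⟩ := (isCompact_closedBall (0 : I → ℝ) 1).tendsto_subseq
    (x := fun n => (P ^ n) *ᵥ e) (fun n => by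
      rw [mem_closedBall_zero_iff, pi_norm_le_iff_of_nonneg zero_le_one]
      intro v
      rw [Real.norm_of_nonneg (hpos n v), ← hes, ← sum_pow_mulVec_of_colSum h1 e n]
      exact Finset.single_le_sum (fun v _ => hpos n v) (Finset.mem_univ v))
  have hps : ∑ v, p v = 1 := by
    have e1 := ((show Continuous fun x : I → ℝ => ∑ v, x v by fun_prop).tendsto p).comp hp
    refine tendsto_nhds_unique e1 (tendsto_const_nhds.congr fun n => ?_)
    simp [sum_pow_mulVec_of_colSum h1, hes]
  have hfix : P *ᵥ p = p := by
    -- `P *ᵥ e - e` has sum zero, so the powers kill it: any limit point is fixed.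
    have e1 := (h (P *ᵥ e - e) (by simp [sum_mulVec_of_colSum h1])).comp hφ.tendsto_atTop
    have e2 := ((show Continuous fun x : I → ℝ => P *ᵥ x - x by fun_prop).tendsto p).comp hp
    rw [← sub_eq_zero]
    refine tendsto_nhds_unique e2 (e1.congr fun n => ?_)
    simp only [Function.comp, Matrix.mulVec_sub, Matrix.mulVec_mulVec]
    rw [← pow_succ, ← pow_succ']
  have hfixn : ∀ n, (P ^ n) *ᵥ p = p := by
    intro n
    induction n with
    | zero => simp
    | succ n ih => rw [pow_succ, ← Matrix.mulVec_mulVec, hfix, ih]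
  refine ⟨p, fun v => ge_of_tendsto' (tendsto_pi_nhds.1 hp v) fun n => hpos _ v, hfix,
    fun u => ?_⟩
  have e1 := (h (u - (∑ v, u v) • p) (by simp [← Finset.mul_sum, hps])).add_const
    ((∑ v, u v) • p)
  rw [zero_add] at e1
  refine e1.congr fun n => ?_
  rw [Matrix.mulVec_sub, Matrix.mulVec_smul, hfixn]
  simp

end Stochastic

/-! ### The transition matrix of an eigenvector and the arithmetic of its entries. -/

section Eigenvector

open Filter Topology Matrix

/-- The column stochastic matrix that a positive eigenvector `y` of `Fᵀ` makes out of `F`. -/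
noncomputable def eigenTransition {I : Type*} (F : Matrix I I ℕ) (y : I → ℝ) (lam : ℝ) :
    Matrix I I ℝ :=
  fun v w => F v w * y v / (lam * y w)

theorem eigenTransition_nonneg {I : Type*} {F : Matrix I I ℕ} {y : I → ℝ} {lam : ℝ}
    (hy : ∀ v, 0 < y v) (hl : 0 < lam) (v w : I) : 0 ≤ eigenTransition F y lam v w := by
  have := hy v
  have := hy w
  unfold eigenTransition
  positivity

theorem eigenTransition_pos_iff {I : Type*} {F : Matrix I I ℕ} {y : I → ℝ} {lam : ℝ}
    (hy : ∀ v, 0 < y v) (hl : 0 < lam) {v w : I} :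
    0 < eigenTransition F y lam v w ↔ F v w ≠ 0 := by
  have h1 := hy v
  have h2 := hy w
  refine ⟨fun h h0 => by simp [eigenTransition, h0] at h, fun h => ?_⟩
  have : (0 : ℝ) < F v w := by exact_mod_cast Nat.pos_of_ne_zero h
  unfold eigenTransition
  positivity

theorem eigenTransition_colSum {I : Type*} [Fintype I] {F : Matrix I I ℕ} {y : I → ℝ} {lam : ℝ}
    (hy : ∀ v, 0 < y v) (hl : 0 < lam) (hF : ∀ w, ∑ v, (F v w : ℝ) * y v = lam * y w) (w : I) :
    ∑ v, eigenTransition F y lam v w = 1 := by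
  have := hy w
  simp only [eigenTransition]
  rw [← Finset.sum_div, hF]
  field_simp

/-- The powers of the transition matrix describe the iteration of `F`. -/
theorem eigenTransition_pow_mulVec {I : Type*} [Fintype I] [DecidableEq I] {F : Matrix I I ℕ}
    {y : I → ℝ} {lam : ℝ} (hy : ∀ v, 0 < y v) (hl : 0 < lam) {b : ℕ → I → ℝ}
    (hb : ∀ n v, b (n + 1) v = ∑ w, F v w * b n w) (n : ℕ) :
    (eigenTransition F y lam ^ n) *ᵥ (fun w => y w * b 0 w) = fun v => y v * b n v / lam ^ n := by
  induction n with
  | zero => simp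
  | succ n ih =>
    rw [pow_succ', ← Matrix.mulVec_mulVec, ih]
    ext v
    simp only [Matrix.mulVec, dotProduct, eigenTransition, hb, Finset.mul_sum, Finset.sum_div]
    refine Finset.sum_congr rfl fun w _ => ?_
    have := hy w
    field_simp
    ring

/-- Stochastic matrices preserve coordinate sums. Consequently `(∑ v, y v * b n v) / lam ^ n` does
not depend on the level `n`. -/
theorem sum_mul_iterate {I : Type*} [Fintype I] [DecidableEq I] {F : Matrix I I ℕ}
    {y : I → ℝ} {lam : ℝ} (hy : ∀ v, 0 < y v) (hl : 0 < lam)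
    (hF : ∀ w, ∑ v, (F v w : ℝ) * y v = lam * y w) {b : ℕ → I → ℝ}
    (hb : ∀ n v, b (n + 1) v = ∑ w, F v w * b n w) (n : ℕ) :
    ∑ v, y v * b n v = lam ^ n * ∑ v, y v * b 0 v := by
  have h := sum_pow_mulVec_of_colSum (eigenTransition_colSum hy hl hF) (fun w => y w * b 0 w) n
  rw [eigenTransition_pow_mulVec hy hl hb, ← Finset.sum_div] at h
  rw [← h]
  field_simp

/-- An eigenvalue of a transposed integer matrix is integral. -/
theorem isIntegral_of_sum_mul_eq {I : Type*} [Fintype I] [Nonempty I] {F : Matrix I I ℕ}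
    {y : I → ℝ} {lam : ℝ} (hy : ∀ v, 0 < y v)
    (hF : ∀ w, ∑ v, (F v w : ℝ) * y v = lam * y w) : IsIntegral ℤ lam := by
  -- Multiplication by `lam` preserves the nonzero finitely generated `ℤ`-module spanned by the
  -- entries of `y`.
  refine isIntegral_of_smul_mem_submodule (M := ℝ) (Submodule.span ℤ (range y)) ?_
    (Submodule.fg_span (finite_range y)) lam ?_
  · obtain ⟨i⟩ := ‹Nonempty I›
    intro h
    have : y i ∈ Submodule.span ℤ (range y) := Submodule.subset_span ⟨i, rfl⟩
    rw [h, Submodule.mem_bot] at this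
    exact (hy i).ne' this
  · intro x hx
    induction hx using Submodule.span_induction with
    | mem x hx =>
      obtain ⟨w, rfl⟩ := hx
      rw [smul_eq_mul, ← hF]
      refine Submodule.sum_mem _ fun v _ => ?_
      have := Submodule.smul_mem (Submodule.span ℤ (range y)) (F v w : ℤ)
        (Submodule.subset_span ⟨v, rfl⟩)
      simpa using this
    | zero => simp
    | add x z _ _ hx hz => rw [smul_add]; exact add_mem hx hz
    | smul c x _ hx => rw [smul_comm]; exact Submodule.smul_mem _ _ hx

/-- If the powers of the transition matrix converge to the projection on `p`, then every coordinate
of `y` is a linear combination over `ℚ(lam)` of the coordinates on the support of `p`. -/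
theorem mem_span_of_tendsto {I : Type*} [Fintype I] [DecidableEq I] {F : Matrix I I ℕ}
    {y : I → ℝ} {lam : ℝ} (hy : ∀ v, 0 < y v) (hl : 0 < lam)
    (hF : ∀ w, ∑ v, (F v w : ℝ) * y v = lam * y w) {p : I → ℝ}
    (hp : ∀ u : I → ℝ, Tendsto (fun n => (eigenTransition F y lam ^ n) *ᵥ u) atTop
      (𝓝 ((∑ v, u v) • p))) (w : I) :
    y w ∈ Submodule.span (IntermediateField.adjoin ℚ {lam}) (y '' {v | p v ≠ 0}) := by
  by_contra hw
  set K := IntermediateField.adjoin ℚ {lam} with hK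
  -- A `K`-linear functional that kills the span but not `y w`. As `lam ∈ K`, its values on `y`
  -- satisfy the same eigenvector equation, so their ratio `g` to `y` is a left fixed vector of the
  -- transition matrix. Testing `g` against the limit `p` gives `g w = 0`.
  obtain ⟨φ, hφ, hφ0⟩ := Submodule.exists_dual_map_eq_bot_of_notMem hw inferInstance
  set z : I → ℝ := fun v => ((φ (y v) : K) : ℝ) with hz
  set g : I → ℝ := fun v => z v / y v with hg
  have hzF : ∀ w, ∑ v, (F v w : ℝ) * z v = lam * z w := by
    intro w
    have hlK : lam ∈ K := IntermediateField.mem_adjoin_simple_self ℚ lam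
    have e1 : φ (∑ v, (F v w : K) • y v) = φ ((⟨lam, hlK⟩ : K) • y w) := by
      congr 1
      simp only [Algebra.smul_def]
      simpa using hF w
    simp only [map_sum, map_smul] at e1
    have := congrArg (fun k : K => (k : ℝ)) e1
    simpa [hz] using this
  have hgP : g ᵥ* eigenTransition F y lam = g := by
    ext w
    have := hy w
    simp only [Matrix.vecMul, dotProduct, hg, eigenTransition]
    rw [eq_div_iff this.ne', ← mul_right_inj' hl.ne', ← hzF, Finset.sum_mul, Finset.mul_sum]
    refine Finset.sum_congr rfl fun v _ => ?_
    have := hy v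
    field_simp
  have hgPn : ∀ n, g ᵥ* (eigenTransition F y lam ^ n) = g := by
    intro n
    induction n with
    | zero => simp
    | succ n ih => rw [pow_succ, ← Matrix.vecMul_vecMul, ih, hgP]
  have hgp : ∀ v, g v * p v = 0 := by
    intro v
    by_cases hv : p v = 0
    · simp [hv]
    have : φ (y v) ∈ Submodule.map φ (Submodule.span K (y '' {v | p v ≠ 0})) :=
      Submodule.mem_map_of_mem (Submodule.subset_span ⟨v, hv, rfl⟩)
    rw [hφ0, Submodule.mem_bot] at this
    simp [hg, hz, this]
  have e1 := ((show Continuous fun x : I → ℝ => g ⬝ᵥ x by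
    simp only [dotProduct]; fun_prop).tendsto _).comp (hp (Pi.single w 1))
  have e2 : g w = 0 := by
    have h0 : g ⬝ᵥ ((∑ v, (Pi.single w 1 : I → ℝ) v) • p) = 0 := by
      simp [dotProduct, hgp]
    rw [h0] at e1
    refine tendsto_nhds_unique (tendsto_const_nhds.congr fun n => ?_) e1
    simp only [Function.comp]
    rw [Matrix.dotProduct_mulVec, hgPn]
    simp
  refine hφ ?_
  have : z w = 0 := by
    have := hy w
    simpa [hg, this.ne'] using e2
  exact Subtype.ext this

/-- An element of the span of `y '' S` over `ℚ(lam)` has a multiple in the group generated by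
`y '' S`, if this group is invariant under multiplication by the algebraic number `lam`. -/
theorem exists_nsmul_mem_of_mem_span {S : Set ℝ} {lam : ℝ} (hint : IsIntegral ℤ lam)
    (hS : ∀ x ∈ S, lam * x ∈ AddSubgroup.closure S) {x : ℝ}
    (hx : x ∈ Submodule.span (IntermediateField.adjoin ℚ {lam}) S) :
    ∃ M : ℕ, 0 < M ∧ M • x ∈ AddSubgroup.closure S := by
  have hadd : ∀ x z : ℝ, (∃ M : ℕ, 0 < M ∧ M • x ∈ AddSubgroup.closure S) →
      (∃ M : ℕ, 0 < M ∧ M • z ∈ AddSubgroup.closure S) →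
      ∃ M : ℕ, 0 < M ∧ M • (x + z) ∈ AddSubgroup.closure S := by
    rintro x z ⟨M, hM, hx⟩ ⟨M', hM', hz⟩
    refine ⟨M * M', Nat.mul_pos hM hM', ?_⟩
    rw [smul_add]
    refine add_mem ?_ ?_
    · rw [mul_comm, mul_smul]; exact AddSubgroup.nsmul_mem _ hx _
    · rw [mul_smul]; exact AddSubgroup.nsmul_mem _ hz _
  have hlam : ∀ x ∈ AddSubgroup.closure S, lam * x ∈ AddSubgroup.closure S := by
    intro x hx
    induction hx using AddSubgroup.closure_induction with
    | mem x hx => exact hS x hx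
    | zero => simp
    | add x z _ _ hx hz => rw [mul_add]; exact add_mem hx hz
    | neg x _ hx => rw [mul_neg]; exact neg_mem hx
  -- A factor `lam` costs nothing and a rational factor costs its denominator. Algebraicity of `lam`
  -- makes `ℚ[lam]` the whole field `ℚ(lam)`.
  have hmul : ∀ k ∈ Algebra.adjoin ℚ {lam}, ∀ x : ℝ,
      (∃ M : ℕ, 0 < M ∧ M • x ∈ AddSubgroup.closure S) →
      ∃ M : ℕ, 0 < M ∧ M • (k * x) ∈ AddSubgroup.closure S := by
    intro k hk
    induction hk using Algebra.adjoin_induction with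
    | mem k hk =>
      rintro x ⟨M, hM, hx⟩
      rw [mem_singleton_iff] at hk
      refine ⟨M, hM, ?_⟩
      rw [hk]
      rw [← mul_smul_comm]
      exact hlam _ hx
    | algebraMap q =>
      rintro x ⟨M, hM, hx⟩
      refine ⟨q.den * M, Nat.mul_pos q.den_pos hM, ?_⟩
      have : (q.den * M) • ((algebraMap ℚ ℝ q) * x) = q.num • (M • x) := by
        have hq : (q.den : ℝ) * (q : ℝ) = q.num := by exact_mod_cast Rat.den_mul_eq_num q
        simp only [nsmul_eq_mul, zsmul_eq_mul, eq_ratCast, Nat.cast_mul]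
        rw [← hq]
        ring
      rw [this]
      exact AddSubgroup.zsmul_mem _ hx _
    | add k l _ _ hk hl =>
      intro x hx
      rw [add_mul]
      exact hadd _ _ (hk x hx) (hl x hx)
    | mul k l _ _ hk hl =>
      intro x hx
      rw [mul_assoc]
      exact hk _ (hl x hx)
  have halg : IsAlgebraic ℚ lam := (hint.tower_top (A := ℚ)).isAlgebraic
  induction hx using Submodule.span_induction with
  | mem x hx => exact ⟨1, one_pos, by simpa using AddSubgroup.subset_closure hx⟩
  | zero => exact ⟨1, one_pos, by simp⟩
  | add x z _ _ hx hz => exact hadd _ _ hx hz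
  | smul k x _ hx =>
    refine hmul k ?_ x hx
    rw [← IntermediateField.adjoin_simple_toSubalgebra_of_isAlgebraic halg]
    exact k.2

theorem mem_closure_image_iff {I : Type*} [Fintype I] {y : I → ℝ} {S : Set I} {x : ℝ} :
    x ∈ AddSubgroup.closure (y '' S) ↔
      ∃ c : I → ℤ, (∀ v ∉ S, c v = 0) ∧ x = ∑ v, y v * c v := by
  classical
  constructor
  · intro hx
    induction hx using AddSubgroup.closure_induction with
    | mem x hx =>
      obtain ⟨v, hv, rfl⟩ := hx
      refine ⟨Pi.single v 1, fun w hw => ?_, ?_⟩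
      · rw [Pi.single_eq_of_ne]
        rintro rfl
        exact hw hv
      · simp [Pi.single_apply]
    | zero => exact ⟨0, by simp, by simp⟩
    | add x z _ _ hx hz =>
      obtain ⟨c, hc, rfl⟩ := hx
      obtain ⟨d, hd, rfl⟩ := hz
      exact ⟨c + d, fun v hv => by simp [hc v hv, hd v hv], by
        simp [mul_add, Finset.sum_add_distrib]⟩
    | neg x _ hx =>
      obtain ⟨c, hc, rfl⟩ := hx
      exact ⟨-c, fun v hv => by simp [hc v hv], by simp⟩
  · rintro ⟨c, hc, rfl⟩
    refine AddSubgroup.sum_mem _ fun v _ => ?_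
    by_cases hv : v ∈ S
    · have := AddSubgroup.zsmul_mem _
        (AddSubgroup.subset_closure (mem_image_of_mem y hv)) (c v)
      simpa [mul_comm] using this
    · simp [hc v hv]

/-- If the sequence of the heights `h n` tends to infinity, then every element of `(0, 1)` of
the form `(∑ v, a v * y v) / lam ^ N` with integers `a v` has such a representation with
`0 ≤ a v ≤ h N v`. -/
theorem exists_le_height_sum_eq {I : Type*} [Fintype I] [DecidableEq I] [Nonempty I]
    {F : Matrix I I ℕ} {y : I → ℝ} {lam : ℝ} (hy : ∀ v, 0 < y v) (hl : 0 < lam)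
    (hF : ∀ w, ∑ v, (F v w : ℝ) * y v = lam * y w) (hy1 : ∑ v, y v = 1)
    (hlim : ∀ u : I → ℝ, ∑ v, u v = 0 →
      Tendsto (fun n => (eigenTransition F y lam ^ n) *ᵥ u) atTop (𝓝 0))
    {h : ℕ → I → ℕ} (h_zero : ∀ v, h 0 v = 1) (h_succ : ∀ n v, h (n + 1) v = ∑ w, F v w * h n w)
    (h_inf : ∀ M, ∃ N, ∀ n ≥ N, ∀ v, M ≤ h n v) {t : ℝ} (ht0 : 0 < t) (ht1 : t < 1) {N₀ : ℕ}
    {a : I → ℤ} (ha : ∑ v, y v * a v = lam ^ N₀ * t) :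
    ∃ n, ∃ k : I → ℕ, (∀ v, k v ≤ h n v) ∧ ∑ v, y v * k v = lam ^ n * t := by
  obtain ⟨p, hp0, hpfix, hp⟩ := exists_stationary_of_tendsto
    (eigenTransition_nonneg (F := F) hy hl) (eigenTransition_colSum hy hl hF) hlim
  have hclosed : ∀ v w, F v w ≠ 0 → p w ≠ 0 → p v ≠ 0 := by
    intro v w hvw hw
    rw [← hpfix]
    refine (lt_of_lt_of_le (mul_pos ((eigenTransition_pos_iff hy hl).2 hvw)
      ((hp0 w).lt_of_ne' hw)) ?_).ne'
    exact Finset.single_le_sum (f := fun w => eigenTransition F y lam v w * p w)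
      (fun w _ => mul_nonneg (eigenTransition_nonneg hy hl v w) (hp0 w)) (Finset.mem_univ w)
  have htor : ∀ w, ∃ M : ℕ, ∃ c : I → ℤ, 0 < M ∧ (∀ v, p v = 0 → c v = 0) ∧
      (M : ℝ) * y w = ∑ v, y v * c v := by
    intro w
    obtain ⟨M, hM, hmem⟩ := exists_nsmul_mem_of_mem_span (isIntegral_of_sum_mul_eq hy hF)
      (S := y '' {v | p v ≠ 0}) (by
        rintro _ ⟨w, hw, rfl⟩
        rw [← hF, mem_closure_image_iff]
        refine ⟨fun v => F v w, fun v hv => ?_, by simp [mul_comm]⟩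
        by_contra h0
        exact hv (hclosed v w (by simpa using h0) hw)) (mem_span_of_tendsto hy hl hF hp w)
    obtain ⟨c, hc, hsum⟩ := mem_closure_image_iff.1 hmem
    exact ⟨M, c, hM, fun v hv => hc v (by simp [hv]), by simpa using hsum⟩
  choose M c hM hc hMc using htor
  have hiter : ∀ a : I → ℤ, ∃ b : ℕ → I → ℤ, b 0 = a ∧
      ∀ n v, b (n + 1) v = ∑ w, F v w * b n w := fun a =>
    ⟨fun n => Nat.rec a (fun _ b v => ∑ w, F v w * b w) n, rfl, fun n v => rfl⟩
  -- From this level on every height exceeds every modulus `M w`.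
  obtain ⟨N₁, hN₁⟩ := h_inf (∑ w, M w)
  set N := max N₀ N₁ with hN
  -- a representation at the level `N`
  obtain ⟨b₁, hb₁0, hb₁⟩ := hiter a
  set a₁ := b₁ (N - N₀) with ha₁
  have hsum₁ : ∑ v, y v * a₁ v = lam ^ N * t := by
    have := sum_mul_iterate (b := fun n v => (b₁ n v : ℝ)) hy hl hF
      (fun n v => by simp [hb₁]) (N - N₀)
    rw [this, hb₁0, ha, ← mul_assoc, ← pow_add, Nat.sub_add_cancel (le_max_left _ _)]
  -- reduction of the coordinates outside the support of `p`
  set q : I → ℤ := fun u => if p u = 0 then a₁ u / M u else 0 with hq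
  set a₂ : I → ℤ := fun w => a₁ w - M w * q w + ∑ u, q u * c u w with ha₂
  -- Each `q u` copies of `M u * y u` are traded for the equal combination with coefficients `c u`.
  have hsum₂ : ∑ v, y v * a₂ v = lam ^ N * t := by
    have e1 : ∑ v, y v * ∑ u, (q u : ℝ) * c u v = ∑ u, y u * (M u * q u) := by
      simp only [Finset.mul_sum]
      rw [Finset.sum_comm]
      refine Finset.sum_congr rfl fun u _ => ?_
      have : y u * (M u * q u) = (q u : ℝ) * (M u * y u) := by ring
      rw [this, hMc, Finset.mul_sum]
      refine Finset.sum_congr rfl fun v _ => by ring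
    simp only [ha₂]
    push_cast
    simp only [mul_add, mul_sub, Finset.sum_add_distrib, Finset.sum_sub_distrib]
    rw [e1, hsum₁]
    ring
  -- The traded combinations vanish off the support of `p`, so only the remainder modulo `M w` is
  -- left.
  have hred : ∀ w, p w = 0 → 0 ≤ a₂ w ∧ a₂ w ≤ h N w := by
    intro w hw
    have hmod : a₂ w = a₁ w % M w := by
      simp only [ha₂, hq, hw, if_true]
      rw [Finset.sum_eq_zero (fun u _ => by rw [hc u w hw, mul_zero]), Int.emod_def]
      ring
    have hMw : (0 : ℤ) < M w := by exact_mod_cast hM w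
    rw [hmod]
    refine ⟨Int.emod_nonneg _ hMw.ne', (Int.emod_lt_of_pos _ hMw).le.trans ?_⟩
    have h1 : M w ≤ ∑ w, M w := Finset.single_le_sum (fun _ _ => Nat.zero_le _) (Finset.mem_univ w)
    exact_mod_cast h1.trans (hN₁ N (le_max_right _ _) w)
  obtain ⟨b, hb0, hb⟩ := hiter a₂
  have hout : ∀ m v, p v = 0 → 0 ≤ b m v ∧ b m v ≤ h (N + m) v := by
    intro m
    induction m with
    | zero => simpa [hb0] using hred
    | succ m ih =>
      intro v hv
      rw [hb, ← add_assoc, h_succ]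
      push_cast
      have hw : ∀ w, 0 ≤ (F v w : ℤ) * b m w ∧ (F v w : ℤ) * b m w ≤ F v w * h (N + m) w := by
        intro w
        by_cases h0 : F v w = 0
        · simp [h0]
        have hpw : p w = 0 := by
          by_contra hpw
          exact hclosed v w h0 hpw hv
        exact ⟨mul_nonneg (by positivity) (ih w hpw).1,
          mul_le_mul_of_nonneg_left (ih w hpw).2 (by positivity)⟩
      exact ⟨Finset.sum_nonneg fun w _ => (hw w).1, Finset.sum_le_sum fun w _ => (hw w).2⟩
  have hin : ∀ v, ∀ᶠ m in atTop, 0 ≤ b m v ∧ b m v ≤ h (N + m) v := by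
    intro v
    by_cases hv : p v = 0
    · exact Eventually.of_forall fun m => hout m v hv
    have hpv : 0 < p v := (hp0 v).lt_of_ne' hv
    have hhN : ∑ v, y v * (h N v : ℝ) = lam ^ N := by
      have := sum_mul_iterate (b := fun n v => (h n v : ℝ)) hy hl hF
        (fun n v => by simp [h_succ]) N
      rw [this]
      simp [h_zero, hy1]
    have htend : ∀ d : ℕ → I → ℝ, (∀ n v, d (n + 1) v = ∑ w, F v w * d n w) →
        Tendsto (fun n => y v * d n v / lam ^ n) atTop (𝓝 ((∑ w, y w * d 0 w) * p v)) := by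
      intro d hd
      refine (tendsto_pi_nhds.1 (hp (fun w => y w * d 0 w)) v).congr fun n => ?_
      rw [eigenTransition_pow_mulVec hy hl hd]
    have tb := htend (fun n v => b n v) fun n v => by simp [hb]
    have th := htend (fun n v => h (N + n) v) fun n v => by simp [h_succ, ← add_assoc]
    -- Both sequences start at level `N`: the limits are `lam ^ N * t * p v` and `lam ^ N * p v`.
    simp only [hb0, hsum₂, add_zero, hhN] at tb th
    have hlN : 0 < lam ^ N := pow_pos hl N
    have hpos : 0 < lam ^ N * t * p v := by positivity
    have hlt : lam ^ N * t * p v < lam ^ N * p v := by nlinarith [mul_pos hlN hpv]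
    filter_upwards [tb.eventually_const_lt hpos, tb.eventually_lt th hlt] with m h1 h2
    have hlm : 0 < lam ^ m := pow_pos hl m
    have hyv := hy v
    rw [div_lt_div_iff_of_pos_right hlm, mul_lt_mul_iff_right₀ hyv] at h2
    rw [div_pos_iff_of_pos_right hlm, mul_pos_iff_of_pos_left hyv] at h1
    constructor
    · exact_mod_cast h1.le
    · exact_mod_cast h2.le
  obtain ⟨m, hm⟩ := (eventually_all.2 hin).exists
  refine ⟨N + m, fun v => (b m v).toNat, fun v => ?_, ?_⟩
  · exact Int.toNat_le.2 (hm v).2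
  · have e1 := sum_mul_iterate (b := fun n v => (b n v : ℝ)) hy hl hF (fun n v => by simp [hb]) m
    simp only [hb0, hsum₂] at e1
    rw [pow_add, mul_comm (lam ^ N), mul_assoc, ← e1]
    refine Finset.sum_congr rfl fun v _ => ?_
    congr 1
    exact_mod_cast Int.toNat_of_nonneg (hm v).1

end Eigenvector

/-! ### Topology of the path space and clopen sets. -/

namespace StationaryBratteliDiagram

open Filter Topology

variable {V E : Type*} {B : StationaryBratteliDiagram V E}

/-- The initial segment of a path down to the level `n + 1`, as its last vertex together with its
recorded edges. -/
def PathSpace.initial (n : ℕ) (x : B.PathSpace) : V × (Fin n → E) := (x.vertex n, fun k => x.1 k)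

theorem PathSpace.initial_eq_iff {n : ℕ} {x z : B.PathSpace} :
    x.initial n = z.initial n ↔ x.vertex n = z.vertex n ∧ ∀ k < n, x.1 k = z.1 k := by
  simp only [PathSpace.initial, Prod.mk.injEq, and_congr_right_iff, funext_iff]
  exact fun _ => ⟨fun h k hk => h ⟨k, hk⟩, fun h k => h k k.2⟩

theorem PathSpace.cylinder_eq (z : B.PathSpace) (n : ℕ) :
    z.cylinder n = PathSpace.initial n ⁻¹' {z.initial n} := by
  ext x
  simp [PathSpace.cylinder, PathSpace.initial_eq_iff]

theorem PathSpace.initial_eq_of_le {m n : ℕ} (hmn : m ≤ n) {x z : B.PathSpace}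
    (h : x.initial n = z.initial n) : x.initial m = z.initial m := by
  rw [PathSpace.initial_eq_iff] at h ⊢
  refine ⟨?_, fun k hk => h.2 k (hk.trans_le hmn)⟩
  rcases hmn.eq_or_lt with rfl | hlt
  · exact h.1
  · simp only [PathSpace.vertex, h.2 m hlt]

theorem PathSpace.isClopen_preimage_initial (n : ℕ) (S : Set (V × (Fin n → E))) :
    IsClopen (PathSpace.initial (B := B) n ⁻¹' S) := by
  let _ : TopologicalSpace E := ⊥
  have : DiscreteTopology E := ⟨rfl⟩
  let _ : TopologicalSpace V := ⊥
  have : DiscreteTopology V := ⟨rfl⟩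
  have hval : Continuous fun x : B.PathSpace => x.1 := continuous_induced_dom
  have hcoord : ∀ k, Continuous fun x : B.PathSpace => x.1 k := fun k =>
    (continuous_apply k).comp hval
  have : Continuous (PathSpace.initial (B := B) n) :=
    (continuous_of_discreteTopology.comp (hcoord n)).prodMk (continuous_pi fun k => hcoord k)
  exact (isClopen_discrete S).preimage this

instance [Finite E] : CompactSpace B.PathSpace := by
  let _ : TopologicalSpace E := ⊥
  have : DiscreteTopology E := ⟨rfl⟩
  let _ : TopologicalSpace V := ⊥
  have : DiscreteTopology V := ⟨rfl⟩
  have hcl : IsClosed {x : ℕ → E | ∀ k, B.r (x k) = B.s (x (k + 1))} := by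
    have : {x : ℕ → E | ∀ k, B.r (x k) = B.s (x (k + 1))} =
        ⋂ k, {x : ℕ → E | B.r (x k) = B.s (x (k + 1))} := by
      ext x
      simp
    rw [this]
    exact isClosed_iInter fun k => isClosed_eq
      (continuous_of_discreteTopology.comp (continuous_apply k))
      (continuous_of_discreteTopology.comp (continuous_apply (k + 1)))
  exact isCompact_iff_compactSpace.1 hcl.isCompact

theorem PathSpace.exists_cylinder_subset {U : Set B.PathSpace} {x : B.PathSpace} (hU : U ∈ 𝓝 x) :
    ∃ n, x.cylinder n ⊆ U := by
  let _ : TopologicalSpace E := ⊥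
  have : DiscreteTopology E := ⟨rfl⟩
  have hU' : U ∈ comap (fun x : B.PathSpace => x.1) (𝓝 x.1) := by
    rw [← nhds_induced]
    exact hU
  obtain ⟨O, hO, hOU⟩ := mem_comap.1 hU'
  rw [nhds_pi, Filter.mem_pi] at hO
  obtain ⟨I, hI, t, ht, htO⟩ := hO
  obtain ⟨m, hm⟩ := hI.bddAbove
  -- The cylinder of index `m + 1` fixes the edges `0, …, m`, hence all constrained coordinates.
  refine ⟨m + 1, fun z hz => hOU (htO fun i hi => ?_)⟩
  have : z.1 i = x.1 i := hz.2 i (Nat.lt_succ_of_le (hm hi))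
  change z.1 i ∈ t i
  rw [this]
  exact mem_of_mem_nhds (ht i)

/-- Nonempty decreasing sets of paths, the `n`-th one depending on the initial segment down to the
level `n + 1` only, have a common point. -/
theorem PathSpace.exists_forall_mem_of_antitone [Finite E] {C : ℕ → Set B.PathSpace}
    (hC : ∀ n, ∃ S, C n = PathSpace.initial n ⁻¹' S) (hanti : ∀ n, C (n + 1) ⊆ C n)
    (hne : ∀ n, (C n).Nonempty) : ∃ x, ∀ n, x ∈ C n := by
  have hcl : ∀ n, IsClosed (C n) := fun n => by
    obtain ⟨S, hS⟩ := hC n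
    rw [hS]
    exact (isClopen_preimage_initial n S).isClosed
  obtain ⟨x, hx⟩ := IsCompact.nonempty_iInter_of_sequence_nonempty_isCompact_isClosed C hanti hne
    (hcl 0).isCompact hcl
  exact ⟨x, mem_iInter.1 hx⟩

/-- A clopen set is a union of cylinder sets of one level. -/
theorem PathSpace.exists_eq_preimage_initial [Finite E] {U : Set B.PathSpace} (hU : IsClopen U) :
    ∃ n S, U = PathSpace.initial n ⁻¹' S := by
  by_contra! hno
  -- Paths whose cylinder meets both `U` and its complement. A path in all of these sets would be a
  -- boundary point of `U`.
  set C : ℕ → Set B.PathSpace := fun n =>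
    {x | ∃ z z', z.initial n = x.initial n ∧ z'.initial n = x.initial n ∧ z ∈ U ∧ z' ∉ U} with hCdef
  obtain ⟨x, hx⟩ := exists_forall_mem_of_antitone (C := C)
    (fun n => ⟨{q | ∃ z z' : B.PathSpace, z.initial n = q ∧ z'.initial n = q ∧ z ∈ U ∧ z' ∉ U},
      rfl⟩)
    (fun n x ⟨z, z', h1, h2, h3, h4⟩ => ⟨z, z', initial_eq_of_le n.le_succ h1,
      initial_eq_of_le n.le_succ h2, h3, h4⟩)
    (fun n => by
      by_contra hemp
      refine hno n (PathSpace.initial n '' U) (Subset.antisymm (subset_preimage_image _ _) ?_)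
      rintro x ⟨z, hz, hzx⟩
      by_contra hxU
      exact hemp ⟨x, z, x, hzx, rfl, hz, hxU⟩)
  by_cases hxU : x ∈ U
  · obtain ⟨n, hn⟩ := exists_cylinder_subset (hU.isOpen.mem_nhds hxU)
    obtain ⟨z, z', h1, h2, h3, h4⟩ := hx n
    exact h4 (hn (initial_eq_iff.1 h2))
  · obtain ⟨n, hn⟩ := exists_cylinder_subset (hU.compl.isOpen.mem_nhds hxU)
    obtain ⟨z, z', h1, h2, h3, h4⟩ := hx n
    exact hn (initial_eq_iff.1 h1) h3

theorem PathSpace.exists_vertex_zero_eq (v : V) : ∃ x : B.PathSpace, x.vertex 0 = v := by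
  choose f hf using B.s_surjective
  let x : ℕ → E := fun k => Nat.rec (f v) (fun _ e => f (B.r e)) k
  exact ⟨⟨x, fun k => (hf (B.r (x k))).symm⟩, hf v⟩

theorem PathSpace.exists_extend {n : ℕ} (x : B.PathSpace) {e : E} (he : x.vertex n = B.s e) :
    ∃ z : B.PathSpace, z.vertex (n + 1) = B.r e ∧ z.1 n = e ∧ ∀ k < n, z.1 k = x.1 k := by
  obtain ⟨t, ht⟩ := exists_vertex_zero_eq (B := B) (B.r e)
  obtain ⟨f, hlt, heq, hgt⟩ : ∃ f : ℕ → E, (∀ k < n, f k = x.1 k) ∧ f n = e ∧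
      ∀ k, f (n + 1 + k) = t.1 k := by
    refine ⟨fun k => if k < n then x.1 k else if k = n then e else t.1 (k - (n + 1)),
      fun k hk => by simp [hk], by simp, fun k => ?_⟩
    simp [show ¬ n + 1 + k < n by omega, show ¬ n + 1 + k = n by omega]
  refine ⟨⟨f, fun k => ?_⟩, ?_, heq, hlt⟩
  · rcases lt_or_ge k n with hk | hk
    · rw [hlt k hk, x.2 k]
      rcases (Nat.succ_le_of_lt hk).eq_or_lt with h | h
      · obtain rfl : k + 1 = n := h
        rw [heq, ← he]
        rfl
      · rw [hlt (k + 1) h]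
    · obtain ⟨d, rfl⟩ := Nat.exists_eq_add_of_le hk
      cases d with
      | zero => rw [add_zero, heq, ← ht, PathSpace.vertex, ← hgt 0, add_zero]
      | succ d =>
        rw [show n + (d + 1) = n + 1 + d by ring, hgt, add_assoc, hgt, t.2 d]
  · exact (congrArg B.s (hgt 0)).trans ht

/-! ### Heights: counting finite paths. -/

variable (B) in
/-- The finite paths from `v₀` to the vertex `v` of the level `n + 1`. -/
def pathsTo (n : ℕ) (v : V) : Set (Fin n → E) := {p | ∃ x : B.PathSpace, x.initial n = (v, p)}

variable (B) in
/-- The number of finite paths from `v₀` to the vertex `v` of the level `n + 1`. -/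
noncomputable def height (n : ℕ) (v : V) : ℕ := (B.pathsTo n v).ncard

theorem height_zero (v : V) : B.height 0 v = 1 := by
  obtain ⟨x, hx⟩ := PathSpace.exists_vertex_zero_eq (B := B) v
  rw [height, ncard_eq_one]
  refine ⟨fun k => x.1 k, ?_⟩
  ext p
  simp only [mem_singleton_iff, pathsTo, mem_ofPred_eq]
  refine ⟨fun _ => Subsingleton.elim _ _, ?_⟩
  rintro rfl
  exact ⟨x, by simp [PathSpace.initial, hx]⟩

/-- Cutting off the last edge is a bijection onto pairs of an edge into `v` and a path to its
source. -/
theorem height_succ [Fintype V] [Finite E] (n : ℕ) (v : V) :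
    B.height (n + 1) v = ∑ w, B.incidence v w * B.height n w := by
  let f : (Σ w : V, {e : E // B.r e = v ∧ B.s e = w} × B.pathsTo n w) → B.pathsTo (n + 1) v :=
    fun q => ⟨Fin.snoc (α := fun _ => E) q.2.2.1 q.2.1.1, by
      obtain ⟨w, ⟨e, rfl, rfl⟩, p, x, hx⟩ := q
      simp only [PathSpace.initial, Prod.mk.injEq] at hx
      obtain ⟨z, hz1, hz2, hz3⟩ := x.exists_extend hx.1
      refine ⟨z, ?_⟩
      simp only [PathSpace.initial, hz1, Prod.mk.injEq, true_and]
      ext k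
      induction k using Fin.lastCases with
      | last => simp [hz2]
      | cast k => simp [hz3 k k.2, ← hx.2]⟩
  have hf : Function.Bijective f := by
    constructor
    · rintro ⟨w, ⟨e, he, rfl⟩, p, hp⟩ ⟨w', ⟨e', he', rfl⟩, p', hp'⟩ h
      have h' := congrArg Subtype.val h
      simp only [f] at h'
      obtain ⟨rfl, rfl⟩ := Fin.snoc_inj.1 h'
      rfl
    · rintro ⟨p, x, hx⟩
      simp only [PathSpace.initial, Prod.mk.injEq] at hx
      obtain ⟨hv, rfl⟩ := hx
      refine ⟨⟨x.vertex n, ⟨x.1 n, (x.2 n).trans hv, rfl⟩, fun k => x.1 k, x, rfl⟩, ?_⟩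
      ext k
      induction k using Fin.lastCases with
      | last => simp [f]
      | cast k => simp [f]
  rw [height, ← Nat.card_coe_set_eq, ← Nat.card_congr (Equiv.ofBijective f hf), Nat.card_sigma]
  refine Finset.sum_congr rfl fun w _ => ?_
  rw [Nat.card_prod, Nat.card_coe_set_eq]
  rfl

theorem incidence_ne_zero [Finite E] (e : E) : B.incidence (B.r e) (B.s e) ≠ 0 := by
  have : Nonempty {e' : E // B.r e' = B.r e ∧ B.s e' = B.s e} := ⟨e, rfl, rfl⟩
  exact Nat.card_pos.ne'

theorem PathSpace.incidence_vertex_ne_zero [Finite E] (x : B.PathSpace) (n : ℕ) :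
    B.incidence (x.vertex (n + 1)) (x.vertex n) ≠ 0 := by
  have h : x.vertex (n + 1) = B.r (x.1 n) := (x.2 n).symm
  rw [h]
  exact incidence_ne_zero _

theorem height_pos [Fintype V] [Finite E] (n : ℕ) (v : V) : 0 < B.height n v := by
  induction n generalizing v with
  | zero => simp [height_zero]
  | succ n ih =>
    rw [height_succ]
    obtain ⟨e, rfl⟩ := B.r_surjective v
    exact (Nat.mul_pos (Nat.pos_of_ne_zero (incidence_ne_zero e)) (ih _)).trans_le
      (Finset.single_le_sum (f := fun w => B.incidence (B.r e) w * B.height n w)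
        (fun _ _ => Nat.zero_le _) (Finset.mem_univ (B.s e)))

theorem height_le_height_succ [Fintype V] [Finite E] (n : ℕ) {v w : V} (h : B.incidence v w ≠ 0) :
    B.height n w ≤ B.height (n + 1) v := by
  rw [height_succ]
  exact (Nat.le_mul_of_pos_left _ (Nat.pos_of_ne_zero h)).trans
    (Finset.single_le_sum (f := fun w => B.incidence v w * B.height n w)
      (fun _ _ => Nat.zero_le _) (Finset.mem_univ w))

theorem measurableSet_eventually_vertex_mem (A : ℕ → Set V) :
    MeasurableSet {x : B.PathSpace | ∃ k₀, ∀ k ≥ k₀, x.vertex k ∈ A k} := by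
  have : {x : B.PathSpace | ∃ k₀, ∀ k ≥ k₀, x.vertex k ∈ A k} =
      ⋃ k₀, ⋂ k, ⋂ _ : k ≥ k₀, PathSpace.initial k ⁻¹' {q | q.1 ∈ A k} := by
    ext x
    simp [PathSpace.initial]
  rw [this]
  exact MeasurableSet.iUnion fun k₀ => MeasurableSet.iInter fun k => MeasurableSet.iInter fun _ =>
    (PathSpace.isClopen_preimage_initial _ _).isOpen.measurableSet

/-! ### Measures of clopen sets, ergodicity and growth of heights. -/

section Measure

variable [Fintype V] [Fintype E] {μ : Measure B.PathSpace} {lam : ℝ} {y : V → ℝ}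

/-- The measure of a union of cylinder sets of one level. -/
theorem IsDefinedBy.measureReal_preimage [IsFiniteMeasure μ] (h : IsDefinedBy μ lam y) (n : ℕ)
    (S : Set (V × (Fin n → E))) :
    μ.real (PathSpace.initial n ⁻¹' S) =
      ∑ v, ({p | p ∈ B.pathsTo n v ∧ (v, p) ∈ S}.ncard : ℝ) * (y v / lam ^ n) := by
  classical
  have e1 : μ.real (PathSpace.initial n ⁻¹' S) =
      ∑ q ∈ Finset.univ.filter (· ∈ S), μ.real (PathSpace.initial n ⁻¹' {q}) := by
    rw [sum_measureReal_preimage_singleton _ fun q _ =>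
      (PathSpace.isClopen_preimage_initial n {q}).isOpen.measurableSet]
    congr 1
    ext x
    simp
  have e2 : ∀ q : V × (Fin n → E), μ.real (PathSpace.initial n ⁻¹' {q}) =
      if q.2 ∈ B.pathsTo n q.1 then y q.1 / lam ^ n else 0 := by
    rintro ⟨v, p⟩
    split_ifs with hq
    · obtain ⟨x, hx⟩ := hq
      have := h n x
      rw [PathSpace.cylinder_eq, hx] at this
      rw [this]
      simp only [PathSpace.initial, Prod.mk.injEq] at hx
      rw [hx.1]
    · have : PathSpace.initial (B := B) n ⁻¹' {(v, p)} = ∅ := by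
        ext x
        simp only [mem_preimage, mem_singleton_iff, mem_empty_iff_false, iff_false]
        exact fun hx => hq ⟨x, hx⟩
      simp [this]
  rw [e1]
  simp only [e2, Finset.sum_filter]
  rw [Fintype.sum_prod_type]
  refine Finset.sum_congr rfl fun v _ => ?_
  simp only [← ite_and]
  rw [← Finset.sum_filter, Finset.sum_const, nsmul_eq_mul]
  congr 2
  rw [ncard_eq_toFinset_card']
  congr 1
  ext p
  simp [and_comm]

/-- The number of cylinder sets in a clopen set can be prescribed for every vertex. -/
theorem IsDefinedBy.exists_isClopen [IsFiniteMeasure μ] (h : IsDefinedBy μ lam y) {n : ℕ}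
    {k : V → ℕ} (hk : ∀ v, k v ≤ B.height n v) :
    ∃ U : Set B.PathSpace, IsClopen U ∧ μ.real U = (∑ v, y v * k v) / lam ^ n := by
  choose T hT hTk using fun v => exists_subset_card_eq (hk v)
  refine ⟨PathSpace.initial n ⁻¹' {q | q.2 ∈ T q.1}, PathSpace.isClopen_preimage_initial _ _, ?_⟩
  rw [h.measureReal_preimage, Finset.sum_div]
  refine Finset.sum_congr rfl fun v _ => ?_
  have : {p | p ∈ B.pathsTo n v ∧ (v, p) ∈ {q : V × (Fin n → E) | q.2 ∈ T q.1}} = T v := by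
    ext p
    simp only [mem_ofPred_eq]
    exact ⟨fun hp => hp.2, fun hp => ⟨hT v hp, hp⟩⟩
  rw [this, hTk]
  ring

theorem IsDefinedBy.ae_vertex_ne [IsFiniteMeasure μ] (h : IsDefinedBy μ lam y) :
    ∀ᵐ x ∂μ, ∀ n, y (x.vertex n) ≠ 0 := by
  rw [ae_all_iff]
  intro n
  have e1 := h.measureReal_preimage n {q | y q.1 = 0}
  rw [Finset.sum_eq_zero fun v _ => ?_, measureReal_eq_zero_iff] at e1
  · rw [ae_iff]
    simpa [PathSpace.initial] using e1
  · by_cases hv : y v = 0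
    · simp [hv]
    · simp [hv]

/-- Almost every path avoids the zeros of `y`, so a path starting at `v` almost surely stays in the
sets `A k`; the cylinder of `v` has positive mass `y v`. -/
theorem IsDefinedBy.measure_eventually_vertex_ne_zero [IsFiniteMeasure μ]
    (h : IsDefinedBy μ lam y) {A : ℕ → Set V} {v : V} (hv : v ∈ A 0) (hyv : y v ≠ 0)
    (hA : ∀ k u w, w ∈ A k → y u ≠ 0 → B.incidence u w ≠ 0 → u ∈ A (k + 1)) :
    μ {x : B.PathSpace | ∃ k₀, ∀ k ≥ k₀, x.vertex k ∈ A k} ≠ 0 := by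
  intro h0
  obtain ⟨z, hz⟩ := PathSpace.exists_vertex_zero_eq (B := B) v
  have hcyl := h 0 z
  rw [hz, pow_zero, div_one] at hcyl
  refine hyv ?_
  rw [← hcyl, measureReal_eq_zero_iff]
  have hae : ∀ᵐ x ∂μ, x ∉ z.cylinder 0 := by
    filter_upwards [h.ae_vertex_ne, measure_eq_zero_iff_ae_notMem.1 h0] with x hx hx' hxz
    refine hx' ⟨0, fun k _ => ?_⟩
    induction k with
    | zero => rw [hxz.1, hz]; exact hv
    | succ k ih => exact hA k _ _ (ih k.zero_le) (hx _) (x.incidence_vertex_ne_zero k)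
  exact measure_eq_zero_iff_ae_notMem.2 hae

/-- An ergodic measure does not admit two disjoint sequences of sets of vertices that are closed
under the edges. -/
theorem IsTailErgodic.false_of_disjoint_closed [IsFiniteMeasure μ] (herg : IsTailErgodic μ)
    (h : IsDefinedBy μ lam y) {A A' : ℕ → Set V} {v v' : V} (hv : v ∈ A 0) (hyv : y v ≠ 0)
    (hv' : v' ∈ A' 0) (hyv' : y v' ≠ 0) (hdisj : ∀ k, Disjoint (A k) (A' k))
    (hA : ∀ k u w, w ∈ A k → y u ≠ 0 → B.incidence u w ≠ 0 → u ∈ A (k + 1))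
    (hA' : ∀ k u w, w ∈ A' k → y u ≠ 0 → B.incidence u w ≠ 0 → u ∈ A' (k + 1)) : False := by
  rcases herg _ (measurableSet_eventually_vertex_mem A) (by
    have key : ∀ x z : B.PathSpace, TailEquiv x z → (∃ k₀, ∀ k ≥ k₀, x.vertex k ∈ A k) →
        ∃ k₀, ∀ k ≥ k₀, z.vertex k ∈ A k := by
      rintro x z ⟨m, hm⟩ ⟨k₀, hk₀⟩
      refine ⟨max m k₀, fun k hk => ?_⟩
      have := hk₀ k (le_of_max_le_right hk)
      rwa [PathSpace.vertex, hm k (le_of_max_le_left hk)] at this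
    intro x z hxz
    exact ⟨key x z hxz, key z x (hxz.imp fun _ hm k hk => (hm k hk).symm)⟩) with h0 | h0
  · exact h.measure_eventually_vertex_ne_zero hv hyv hA h0
  · refine h.measure_eventually_vertex_ne_zero hv' hyv' hA' (measure_mono_null ?_ h0)
    rintro x ⟨k, hk⟩ ⟨m, hm⟩
    exact Set.disjoint_left.1 (hdisj (max k m)) (hm _ (le_max_right _ _)) (hk _ (le_max_left _ _))

/-- If the tail equivalence classes of the paths in the support of `μ` are infinite, then the
numbers of paths to the vertices of the support of `y` tend to infinity. -/
theorem IsDefinedBy.exists_forall_le_height [IsFiniteMeasure μ] (h : IsDefinedBy μ lam y)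
    (hy : ∀ v, 0 ≤ y v) (hl : 0 < lam) (hclosed : ∀ v w, B.incidence v w ≠ 0 → y v ≠ 0 → y w ≠ 0)
    (haper : ∀ x ∈ μ.support, {z : B.PathSpace | TailEquiv x z}.Infinite) (M : ℕ) :
    ∃ N, ∀ n ≥ N, ∀ v, y v ≠ 0 → M ≤ B.height n v := by
  obtain ⟨N, hN⟩ : ∃ N, ∀ v, y v ≠ 0 → M ≤ B.height N v := by
    by_contra! hno
    -- By compactness, low heights at every level produce one path through low vertices of the
    -- support of `y`; it lies in the support of `μ`.
    obtain ⟨x, hx⟩ := PathSpace.exists_forall_mem_of_antitone (B := B)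
      (C := fun n => {x | y (x.vertex n) ≠ 0 ∧ B.height n (x.vertex n) < M})
      (fun n => ⟨{q | y q.1 ≠ 0 ∧ B.height n q.1 < M}, rfl⟩)
      (fun n x hx => ⟨hclosed _ _ (x.incidence_vertex_ne_zero n) hx.1,
        (height_le_height_succ n (x.incidence_vertex_ne_zero n)).trans_lt hx.2⟩)
      (fun n => by
        obtain ⟨v, hv, hlt⟩ := hno n
        obtain ⟨p, x, hx⟩ := (ncard_pos).1 (height_pos (B := B) n v)
        simp only [PathSpace.initial, Prod.mk.injEq] at hx
        exact ⟨x, by simp only [mem_ofPred_eq, hx.1]; exact ⟨hv, hlt⟩⟩)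
    have hsupp : x ∈ μ.support := by
      rw [Measure.mem_support_iff_forall]
      intro U hU
      obtain ⟨n, hn⟩ := PathSpace.exists_cylinder_subset hU
      refine lt_of_lt_of_le ?_ (measure_mono hn)
      have hpos : 0 < μ.real (x.cylinder n) := by
        rw [h n x]
        exact div_pos ((hy _).lt_of_ne' (hx n).1) (pow_pos hl n)
      exact (ENNReal.toReal_pos_iff.1 hpos).1
    obtain ⟨T, hT, hTcard⟩ := (haper x hsupp).exists_subset_card_eq M
    have hex : ∃ m, ∀ z ∈ T, ∀ k ≥ m, x.1 k = z.1 k := by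
      choose! f hf using fun z (hz : z ∈ T) => (hT hz : TailEquiv x z)
      refine ⟨∑ z ∈ T, f z, fun z hz k hk => hf z hz k (le_trans ?_ hk)⟩
      exact Finset.single_le_sum (f := f) (fun _ _ => Nat.zero_le _) hz
    obtain ⟨m, hm⟩ := hex
    -- The `M` chosen paths agree with `x` from `m` on, so they differ in their initial segments,
    -- all of which end at `x.vertex m`.
    have hle : M ≤ B.height m (x.vertex m) := by
      rw [← hTcard, ← ncard_coe_finset, height]
      refine ncard_le_ncard_of_injOn (fun z => (z.initial m).2) ?_ ?_ (toFinite _)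
      · intro z hz
        refine ⟨z, ?_⟩
        simp only [PathSpace.initial, Prod.mk.injEq, and_true, PathSpace.vertex]
        rw [hm z hz m le_rfl]
      · intro z hz z' hz' hzz
        refine Subtype.ext (funext fun k => ?_)
        by_cases hk : k < m
        · exact congrFun hzz ⟨k, hk⟩
        · rw [← hm z hz k (not_lt.1 hk), ← hm z' hz' k (not_lt.1 hk)]
    exact absurd (hx m).2 (not_lt.2 hle)
  refine ⟨N, fun n hn => ?_⟩
  induction n, hn using Nat.le_induction with
  | base => exact hN
  | succ n _ ih =>
    intro v hv
    obtain ⟨e, rfl⟩ := B.r_surjective v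
    exact (ih _ (hclosed _ _ (incidence_ne_zero e) hv)).trans
      (height_le_height_succ n (incidence_ne_zero e))

end Measure

/-! ### Positivity of the eigenvalue and the support of the eigenvector. -/

section Eigenpair

variable [Fintype V] {lam : ℝ} {y : V → ℝ}

theorem IsDistinguishedEigenpair.sum_incidence_mul (h : B.IsDistinguishedEigenpair lam y) (w : V) :
    ∑ v, (B.incidence v w : ℝ) * y v = lam * y w := by
  simpa [Matrix.mulVec, dotProduct, A] using congrFun h.eigen w

/-- In the eigenvector equation at `w` the nonnegative terms cannot cancel. Thus the support of `y`
is closed under passing to sources of edges, which lets the height recursion restrict to it. -/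
theorem IsDistinguishedEigenpair.ne_zero_of_incidence (h : B.IsDistinguishedEigenpair lam y)
    {v w : V} (hvw : B.incidence v w ≠ 0) (hv : y v ≠ 0) : y w ≠ 0 := by
  intro hw
  have hsum := h.sum_incidence_mul w
  rw [hw, mul_zero, Finset.sum_eq_zero_iff_of_nonneg fun v _ =>
    mul_nonneg (Nat.cast_nonneg _) (h.nonneg v)] at hsum
  have := hsum v (Finset.mem_univ v)
  simp [hvw, hv] at this

theorem IsDistinguishedEigenpair.exists_ne_zero (h : B.IsDistinguishedEigenpair lam y) :
    ∃ v, y v ≠ 0 := by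
  by_contra! hno
  simpa [hno] using h.sum_eq_one

theorem IsDistinguishedEigenpair.pos [Finite E] (h : B.IsDistinguishedEigenpair lam y) :
    0 < lam := by
  obtain ⟨v, hv⟩ := h.exists_ne_zero
  obtain ⟨e, rfl⟩ := B.r_surjective v
  have hpos : 0 < lam * y (B.s e) := by
    rw [← h.sum_incidence_mul]
    refine Finset.sum_pos' (fun v _ => mul_nonneg (Nat.cast_nonneg _) (h.nonneg v))
      ⟨B.r e, Finset.mem_univ _, mul_pos ?_ ((h.nonneg _).lt_of_ne' hv)⟩
    exact_mod_cast Nat.pos_of_ne_zero (incidence_ne_zero e)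
  exact pos_of_mul_pos_left hpos (h.nonneg _)

end Eigenpair

end StationaryBratteliDiagram

/-! ### Restriction to the support of the eigenvector. -/

theorem sum_subtype_ne_zero {V M : Type*} [Fintype V] [AddCommMonoid M] {y : V → ℝ}
    [Fintype {v // y v ≠ 0}] {f : V → M} (hf : ∀ v, y v = 0 → f v = 0) :
    ∑ v : {v // y v ≠ 0}, f v = ∑ v, f v := by
  classical
  rw [← Finset.sum_subtype (p := fun v => y v ≠ 0) (Finset.univ.filter fun v => y v ≠ 0)
    (by simp) f, Finset.sum_filter]
  refine Finset.sum_congr rfl fun v _ => ?_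
  split_ifs with hv
  · rfl
  · exact (hf v (not_not.1 hv)).symm

namespace StationaryBratteliDiagram

open Filter Topology

variable {V E : Type*} {B : StationaryBratteliDiagram V E} [Fintype V] {lam : ℝ} {y : V → ℝ}

theorem IsDistinguishedEigenpair.sum_subtype_incidence_mul (h : B.IsDistinguishedEigenpair lam y)
    [Fintype {v // y v ≠ 0}] (w : V) :
    ∑ v : {v // y v ≠ 0}, (B.incidence v w : ℝ) * y v = lam * y w := by
  rw [← h.sum_incidence_mul]
  exact sum_subtype_ne_zero (f := fun v => (B.incidence v w : ℝ) * y v) fun v hv => by simp [hv]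

/-- The group of the values `h / lam ^ N` with `h ∈ H`. -/
def divPowSubgroup (H : AddSubgroup ℝ) (lam : ℝ) (hH : ∀ h ∈ H, lam * h ∈ H) :
    AddSubgroup ℝ where
  carrier := {t | ∃ N : ℕ, lam ^ N * t ∈ H}
  zero_mem' := ⟨0, by simp⟩
  add_mem' := by
    -- Since `lam * H ⊆ H`, exponents can be raised to a common one.
    have key : ∀ (k N : ℕ) (t : ℝ), lam ^ N * t ∈ H → lam ^ (k + N) * t ∈ H := by
      intro k N t ht
      induction k with
      | zero => simpa using ht
      | succ k ih =>
        rw [add_right_comm, pow_succ', mul_assoc]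
        exact hH _ ih
    rintro s t ⟨N, hN⟩ ⟨M, hM⟩
    refine ⟨N + M, ?_⟩
    rw [mul_add]
    refine add_mem ?_ (key N M t hM)
    rw [add_comm]
    exact key M N s hN
  neg_mem' := by
    rintro t ⟨N, hN⟩
    exact ⟨N, by rw [mul_neg]; exact neg_mem hN⟩

/-- For an ergodic measure the powers of the transition matrix kill the vectors with sum zero. -/
theorem IsTailErgodic.tendsto_eigenTransition_pow [Fintype E] [DecidableEq V]
    [Fintype {v // y v ≠ 0}] {μ : Measure B.PathSpace} [IsFiniteMeasure μ]
    (herg : IsTailErgodic μ) (h : B.IsDistinguishedEigenpair lam y) (hμ : IsDefinedBy μ lam y)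
    {u : {v // y v ≠ 0} → ℝ} (hu : ∑ v, u v = 0) :
    Tendsto (fun n => (eigenTransition (fun v w : {v // y v ≠ 0} => B.incidence v w)
      (fun v => y v) lam ^ n).mulVec u) atTop (𝓝 0) := by
  have hy : ∀ v : {v // y v ≠ 0}, 0 < y v := fun v => (h.nonneg v).lt_of_ne' v.2
  by_contra hlim
  obtain ⟨A, A', ⟨v, hv⟩, ⟨v', hv'⟩, hdisj, hA, hA'⟩ := exists_disjoint_closed_of_not_tendsto
    (eigenTransition_nonneg hy h.pos)
    (eigenTransition_colSum hy h.pos fun w => h.sum_subtype_incidence_mul w) hu hlim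
  have key : ∀ A : ℕ → Set {v // y v ≠ 0},
      (∀ k v w, w ∈ A k → 0 < eigenTransition
        (fun v w : {v // y v ≠ 0} => B.incidence v w) (fun v => y v) lam v w → v ∈ A (k + 1)) →
      ∀ k u w, w ∈ Subtype.val '' A k → y u ≠ 0 → B.incidence u w ≠ 0 →
        u ∈ Subtype.val '' A (k + 1) := by
    rintro A hA k u _ ⟨w, hw, rfl⟩ hu huw
    exact ⟨⟨u, hu⟩, hA k _ w hw ((eigenTransition_pos_iff hy h.pos).2 huw), rfl⟩
  exact herg.false_of_disjoint_closed hμ (A := fun k => Subtype.val '' A k)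
    (A' := fun k => Subtype.val '' A' k) ⟨v, hv, rfl⟩ v.2 ⟨v', hv', rfl⟩ v'.2
    (fun k => (disjoint_image_iff Subtype.val_injective).2 (hdisj k)) (key A hA) (key A' hA')

end StationaryBratteliDiagram

/-! ### The clopen values set. -/

open StationaryBratteliDiagram in
theorem mainTheorem1 {V E : Type*} [Fintype V] [Fintype E]
    (B : StationaryBratteliDiagram V E)
    (μ : Measure B.PathSpace) [IsProbabilityMeasure μ]
    (h_invariant : IsTailInvariant μ) (h_ergodic : IsTailErgodic μ)
    (h_aperiodic : ∀ x ∈ μ.support, {z : B.PathSpace | TailEquiv x z}.Infinite)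
    (lam : ℝ) (y : V → ℝ) (h_eigen : B.IsDistinguishedEigenpair lam y)
    (h_defined : IsDefinedBy μ lam y)
    (H : AddSubgroup ℝ) (hH : H = AddSubgroup.closure (Set.range (reducedVector y))) :
    IsGroupLike (clopenValues μ) ∧
      clopenValues μ = (⋃ N : ℕ, {t : ℝ | ∃ h ∈ H, t = 1 / lam ^ N * h}) ∩ Set.Icc 0 1 := by
  classical
  have hl : 0 < lam := h_eigen.pos
  have hy : ∀ v : {v // y v ≠ 0}, 0 < y v := fun v => (h_eigen.nonneg v).lt_of_ne' v.2
  have hHiff : ∀ x, x ∈ H ↔ ∃ c : {v // y v ≠ 0} → ℤ, x = ∑ v : {v // y v ≠ 0}, y v * c v := by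
    intro x
    rw [hH, ← image_univ, mem_closure_image_iff]
    simp [reducedVector]
  have hmemH : ∀ v, y v ∈ H := by
    intro v
    by_cases hv : y v = 0
    · rw [hv]; exact zero_mem H
    · rw [hH]; exact AddSubgroup.subset_closure ⟨⟨v, hv⟩, rfl⟩
  have hlamH : ∀ h ∈ H, lam * h ∈ H := by
    intro h hh
    rw [hH] at hh
    induction hh using AddSubgroup.closure_induction with
    | mem x hx =>
      obtain ⟨w, rfl⟩ := hx
      rw [reducedVector, ← h_eigen.sum_incidence_mul]
      refine AddSubgroup.sum_mem _ fun v _ => ?_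
      rw [← nsmul_eq_mul]
      exact AddSubgroup.nsmul_mem _ (hmemH v) _
    | zero => simp
    | add x z _ _ hx hz => rw [mul_add]; exact add_mem hx hz
    | neg x _ hx => rw [mul_neg]; exact neg_mem hx
  have hunion : (⋃ N : ℕ, {t : ℝ | ∃ h ∈ H, t = 1 / lam ^ N * h}) =
      (divPowSubgroup H lam hlamH : Set ℝ) := by
    ext t
    simp only [mem_iUnion, mem_ofPred_eq, SetLike.mem_coe]
    refine exists_congr fun N => ?_
    have hlN : lam ^ N ≠ 0 := pow_ne_zero _ hl.ne'
    constructor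
    · rintro ⟨h, hh, rfl⟩
      rwa [← mul_assoc, mul_one_div_cancel hlN, one_mul]
    · intro ht
      exact ⟨_, ht, by rw [← mul_assoc, one_div_mul_cancel hlN, one_mul]⟩
  have hval : clopenValues μ =
      (⋃ N : ℕ, {t : ℝ | ∃ h ∈ H, t = 1 / lam ^ N * h}) ∩ Set.Icc 0 1 := by
    apply Subset.antisymm
    · rintro _ ⟨U, hU, rfl⟩
      refine ⟨?_, measureReal_nonneg, measureReal_le_one⟩
      obtain ⟨n, S, rfl⟩ := PathSpace.exists_eq_preimage_initial hU
      refine mem_iUnion.2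
        ⟨n, ∑ v, ({p | p ∈ B.pathsTo n v ∧ (v, p) ∈ S}.ncard : ℝ) * y v, ?_, ?_⟩
      · refine AddSubgroup.sum_mem _ fun v _ => ?_
        rw [← nsmul_eq_mul]
        exact AddSubgroup.nsmul_mem _ (hmemH v) _
      · rw [h_defined.measureReal_preimage, Finset.mul_sum]
        exact Finset.sum_congr rfl fun v _ => by ring
    · rintro t ⟨ht, ht0, ht1⟩
      -- The asymptotic comparison needs `0 < t < 1`; the endpoints are the values of `∅` and
      -- `univ`.
      rcases ht0.eq_or_lt with rfl | ht0
      · exact ⟨∅, isClopen_empty, by simp⟩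
      rcases ht1.eq_or_lt with rfl | ht1
      · exact ⟨univ, isClopen_univ, by simp⟩
      obtain ⟨N, h, hh, hth⟩ := mem_iUnion.1 ht
      obtain ⟨a, ha⟩ := (hHiff h).1 hh
      obtain ⟨v₀, hv₀⟩ := h_eigen.exists_ne_zero
      have : Nonempty {v // y v ≠ 0} := ⟨⟨v₀, hv₀⟩⟩
      obtain ⟨n, k, hk, hsum⟩ := exists_le_height_sum_eq
        (F := fun v w : {v // y v ≠ 0} => B.incidence v w) (y := fun v => y v) hy hl
        (fun w => h_eigen.sum_subtype_incidence_mul w)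
        ((sum_subtype_ne_zero (f := y) fun v hv => hv).trans h_eigen.sum_eq_one)
        (fun u hu => h_ergodic.tendsto_eigenTransition_pow h_eigen h_defined hu)
        (h := fun n v => B.height n v) (fun v => height_zero _)
        (fun n v => by
          rw [height_succ]
          refine (sum_subtype_ne_zero (f := fun w => B.incidence v w * B.height n w)
            fun w hw => ?_).symm
          have : B.incidence v w = 0 := by
            by_contra hvw
            exact h_eigen.ne_zero_of_incidence hvw v.2 hw
          rw [this, zero_mul])
        (fun M => by
          obtain ⟨N, hN⟩ := h_defined.exists_forall_le_height h_eigen.nonneg hl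
            (fun v w => h_eigen.ne_zero_of_incidence) h_aperiodic M
          exact ⟨N, fun n hn v => hN n hn v v.2⟩)
        ht0 ht1 (N₀ := N) (a := a) (by
          rw [← ha, hth, ← mul_assoc, mul_one_div_cancel (pow_ne_zero _ hl.ne'), one_mul])
      -- Vertices with `y v = 0` contribute no measure, so no cylinder is taken there.
      obtain ⟨U, hU, hμU⟩ := h_defined.exists_isClopen (n := n)
        (k := fun v => if hv : y v ≠ 0 then k ⟨v, hv⟩ else 0) (fun v => by
          split_ifs with hv
          · exact hk ⟨v, hv⟩
          · exact Nat.zero_le _)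
      refine ⟨U, hU, ?_⟩
      rw [hμU, ← sum_subtype_ne_zero (y := y) fun v hv => by simp [hv],
        div_eq_iff (pow_ne_zero _ hl.ne'), mul_comm t, ← hsum]
      refine Finset.sum_congr rfl fun v _ => ?_
      rw [dif_pos v.2]
  exact ⟨⟨_, hval.trans (by rw [hunion])⟩, hval⟩
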